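/- All compact groups are Hausdorff topological groups, and morphisms of compact groups are continuous homomorphisms. Let $H$ be a compact group, let $(G_i)_{i\in I}$ be a (possibly empty or infinite) family of compact groups indexed by a set $I$, and let $\iota_i : H \to G_i$ $(i\in I)$ be injective continuous homomorphisms whose images $\iota_i(H)$ are normal subgroups of $G_i$. Let $\Gamma=\coprod_{H,\mathrm{Gp}} G_i$ be the free product of the groups $G_i$ amalgamated over $H$, i.e. the colimit in the category of (abstract) groups of the diagram formed by the maps $\iota_i:H\to G_i$. Equip $\Gamma$ with the finest group topology for which the canonical maps $G_i\to\Gamma$ and $H\to\Gamma$ are continuous. The Bohr compactification of the topological group $\Gamma$ is the universal compact group $b\Gamma$ equipped with a continuous homomorphism $\Gamma\to b\Gamma$ (not required to be injective): every continuous homomorphism from $\Gamma$ to a compact group factors uniquely through $b\Gamma$ by a continuous homomorphism. Thus $b\Gamma=\coprod_{H} G_i$ is the colimit of the diagram $(\iota_i)$ in the category of compact groups. The family $(\iota_i)$ is called *algebraically sound* if the canonical map $\coprod_{H,\mathrm{Gp}} G_i=\Gamma\to b\Gamma=\coprod_H G_i$ is one-to-one. It is called *coherently embeddable* if there are a compact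 group $G$ and injective continuous homomorphisms $j_i:G_i\to G$ $(i\in I)$ such that all the composites $j_i\circ\iota_i:H\to G$ are equal. **Theorem.** The family $(\iota_i)_{i\in I}$ is algebraically sound if and only if it is coherently embeddable. -/

import Mathlib

universe u

namespace CompactAmalgam

section Bohr

variable (Γ : Type u) [Group Γ] [TopologicalSpace Γ]

/-- Compact Hausdorff groups whose underlying set is a set of sets of subsets of `Γ`, together with
a continuous morphism from `Γ`. Up to isomorphism, every compact group with a dense continuous
image of `Γ` occurs here; this is the (small) solution set for the Bohr compactification. -/
structure CompactTarget : Type u where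
  carrier : Set (Set (Set Γ))
  [group : Group carrier]
  [topology : TopologicalSpace carrier]
  [topologicalGroup : IsTopologicalGroup carrier]
  [compact : CompactSpace carrier]
  [hausdorff : T2Space carrier]
  hom : Γ →ₜ* carrier

attribute [instance] CompactTarget.group CompactTarget.topology CompactTarget.topologicalGroup
  CompactTarget.compact CompactTarget.hausdorff

/-- The diagonal morphism of `Γ` into the product of all its small compact targets. -/
def diagonal : Γ →* (∀ t : CompactTarget Γ, t.carrier) :=
  MonoidHom.pi fun t => t.hom.toMonoidHom

theorem continuous_diagonal : Continuous (diagonal Γ) :=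
  continuous_pi fun t => t.hom.continuous_toFun

/-- The Bohr compactification of a topological group `Γ`: the closure of the image of `Γ` in the
product of its small compact targets. Its universal property is `bohr_existsUnique`. -/
def BohrCompactification : Type u := (diagonal Γ).range.topologicalClosure

instance : Group (BohrCompactification Γ) :=
  inferInstanceAs (Group (diagonal Γ).range.topologicalClosure)

instance : TopologicalSpace (BohrCompactification Γ) :=
  inferInstanceAs (TopologicalSpace (diagonal Γ).range.topologicalClosure)

instance : IsTopologicalGroup (BohrCompactification Γ) :=
  inferInstanceAs (IsTopologicalGroup (diagonal Γ).range.topologicalClosure)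

instance : T2Space (BohrCompactification Γ) :=
  inferInstanceAs (T2Space (diagonal Γ).range.topologicalClosure)

instance : CompactSpace (BohrCompactification Γ) :=
  isCompact_iff_compactSpace.mp (diagonal Γ).range.isClosed_topologicalClosure.isCompact

/-- The canonical continuous morphism from `Γ` to its Bohr compactification. -/
def toBohr : Γ →ₜ* BohrCompactification Γ where
  toFun x := ⟨diagonal Γ x, subset_closure ⟨x, rfl⟩⟩
  map_one' := Subtype.ext (map_one _)
  map_mul' x y := Subtype.ext (map_mul _ x y)
  continuous_toFun := (continuous_diagonal Γ).subtype_mk _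

theorem denseRange_toBohr : DenseRange (toBohr Γ) := by
  intro x
  refine closure_subtype.mpr ?_
  have : (Subtype.val '' Set.range (toBohr Γ)) =
      ((diagonal Γ).range : Set (∀ t : CompactTarget Γ, t.carrier)) := by
    ext y
    constructor
    · rintro ⟨_, ⟨g, rfl⟩, rfl⟩
      exact ⟨g, rfl⟩
    · rintro ⟨g, rfl⟩
      exact ⟨toBohr Γ g, ⟨g, rfl⟩, rfl⟩
  exact this ▸ x.2

variable {Γ}

/-- The universal property of the Bohr compactification: each continuous morphism from `Γ` to a
compact Hausdorff group factors uniquely through it. -/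
theorem bohr_existsUnique {K : Type*} [Group K] [TopologicalSpace K] [IsTopologicalGroup K]
    [CompactSpace K] [T2Space K] (f : Γ →ₜ* K) :
    ∃! g : BohrCompactification Γ →ₜ* K, ∀ x, g (toBohr Γ x) = f x := by
  let C : Subgroup K := f.toMonoidHom.range.topologicalClosure
  have hmem : ∀ x, f x ∈ C := fun x => subset_closure ⟨x, rfl⟩
  have : CompactSpace C :=
    isCompact_iff_compactSpace.mp (f.toMonoidHom.range.isClosed_topologicalClosure.isCompact)
  let e : C → Set (Set Γ) := fun c => {A | (c : K) ∈ closure (f '' A)}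
  have he : Function.Injective e := by
    intro c d hcd
    by_contra hne
    obtain ⟨U, V, hU, hV, hcU, hdV, hUV⟩ := t2_separation (fun h => hne (Subtype.ext h) : (c : K) ≠ d)
    have hc : f ⁻¹' U ∈ e c := by
      change (c : K) ∈ closure (f '' (f ⁻¹' U))
      rw [mem_closure_iff]
      intro W hW hcW
      have hcC : (c : K) ∈ closure (f.toMonoidHom.range : Set K) := c.2
      obtain ⟨y, hy, x, rfl⟩ := mem_closure_iff.mp hcC (W ∩ U) (hW.inter hU) ⟨hcW, hcU⟩
      exact ⟨f x, hy.1, x, hy.2, rfl⟩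
    rw [hcd] at hc
    obtain ⟨y, hyV, x, hx, rfl⟩ := mem_closure_iff.mp (show (d : K) ∈ closure _ from hc) V hV hdV
    exact Set.disjoint_left.mp hUV hx hyV
  let q : Set.range e ≃ C := (Equiv.ofInjective e he).symm
  let : Group (Set.range e) := q.group
  let : TopologicalSpace (Set.range e) := TopologicalSpace.induced q inferInstance
  let m : Set.range e ≃* C := q.mulEquiv
  have hmcont : Continuous m := continuous_induced_dom
  let h : Set.range e ≃ₜ C := q.toHomeomorphOfIsInducing ⟨rfl⟩
  have : IsTopologicalGroup (Set.range e) := topologicalGroup_induced m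
  have : CompactSpace (Set.range e) := h.symm.compactSpace
  have : T2Space (Set.range e) := h.symm.t2Space
  let t : CompactTarget Γ :=
    { carrier := Set.range e
      hom :=
        { toFun := fun x => m.symm ⟨f x, hmem x⟩
          map_one' := by
            exact (congrArg m.symm (Subtype.ext (map_one f))).trans (map_one m.symm)
          map_mul' := fun x y => by
            rw [← map_mul]; exact congrArg _ (Subtype.ext (map_mul f x y))
          continuous_toFun := h.symm.continuous.comp (f.continuous_toFun.subtype_mk hmem) } }
  let g : BohrCompactification Γ →ₜ* K :=
    { toFun := fun b => (m (b.1 t) : C)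
      map_one' := by
        change ((m (1 : t.carrier) : C) : K) = 1
        exact congrArg Subtype.val (map_one m)
      map_mul' := fun a b => by
        change ((m (a.1 t * b.1 t) : C) : K) = _
        exact congrArg Subtype.val (map_mul m (a.1 t) (b.1 t))
      continuous_toFun := continuous_subtype_val.comp
        (hmcont.comp ((continuous_apply t).comp continuous_subtype_val)) }
  have hg : ∀ x, g (toBohr Γ x) = f x := fun x =>
    congrArg Subtype.val (m.apply_symm_apply ⟨f x, hmem x⟩)
  refine ⟨g, hg, fun g' hg' => ?_⟩
  apply DFunLike.coe_injective
  refine (denseRange_toBohr Γ).equalizer g'.continuous_toFun g.continuous_toFun ?_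
  funext x
  exact (hg' x).trans (hg x).symm

end Bohr

section Pushout

variable {ι H : Type u} [Group H] [TopologicalSpace H]
  {G : ι → Type u} [∀ i, Group (G i)] [∀ i, TopologicalSpace (G i)]

/-- The group-theoretic multi-pushout (free product of the `G i` amalgamated over `H`). -/
def AlgPushout (φ : ∀ i, H →ₜ* G i) : Type u :=
  Monoid.PushoutI fun i => (φ i).toMonoidHom

variable (φ : ∀ i, H →ₜ* G i)

instance : Group (AlgPushout φ) :=
  inferInstanceAs (Group (Monoid.PushoutI fun i => (φ i).toMonoidHom))

/-- The structure map `G i → AlgPushout φ`. -/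
def AlgPushout.of (i : ι) : G i →* AlgPushout φ :=
  Monoid.PushoutI.of (φ := fun i => (φ i).toMonoidHom) i

/-- The structure map `H → AlgPushout φ`. -/
def AlgPushout.base : H →* AlgPushout φ :=
  Monoid.PushoutI.base fun i => (φ i).toMonoidHom

/-- The finest group topology on the algebraic multi-pushout making all structure maps continuous
(topologies are ordered with the finer ones smaller). The map from `H` is listed separately only
for the sake of the empty family. -/
def AlgPushout.groupTopology : GroupTopology (AlgPushout φ) :=
  sInf {t | (∀ i, @Continuous _ _ _ t.toTopologicalSpace (AlgPushout.of φ i)) ∧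
    @Continuous _ _ _ t.toTopologicalSpace (AlgPushout.base φ)}

instance instTopologicalSpaceAlgPushout : TopologicalSpace (AlgPushout φ) := (AlgPushout.groupTopology φ).toTopologicalSpace

instance : IsTopologicalGroup (AlgPushout φ) := (AlgPushout.groupTopology φ).toIsTopologicalGroup

theorem AlgPushout.topology_eq : instTopologicalSpaceAlgPushout φ =
    sInf (GroupTopology.toTopologicalSpace ''
      {t : GroupTopology (AlgPushout φ) |
        (∀ i, @Continuous _ _ _ t.toTopologicalSpace (AlgPushout.of φ i)) ∧
        @Continuous _ _ _ t.toTopologicalSpace (AlgPushout.base φ)}) :=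
  GroupTopology.toTopologicalSpace_sInf _

theorem AlgPushout.continuous_of (i : ι) : Continuous (AlgPushout.of φ i) := by
  rw [AlgPushout.topology_eq φ, continuous_sInf_rng]
  rintro _ ⟨t, ht, rfl⟩
  exact ht.1 i

theorem AlgPushout.continuous_base : Continuous (AlgPushout.base φ) := by
  rw [AlgPushout.topology_eq φ, continuous_sInf_rng]
  rintro _ ⟨t, ht, rfl⟩
  exact ht.2

/-- The multi-pushout in the category of compact groups: the Bohr compactification of the algebraic
multi-pushout. Its universal property is `compactPushout_existsUnique`. -/
abbrev CompactPushout : Type u := BohrCompactification (AlgPushout φ)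

theorem compactPushout_existsUnique {K : Type*} [Group K] [TopologicalSpace K]
    [IsTopologicalGroup K] [CompactSpace K] [T2Space K] (f : ∀ i, G i →ₜ* K) (k : H →ₜ* K)
    (hf : ∀ i x, f i (φ i x) = k x) :
    ∃! g : CompactPushout φ →ₜ* K,
      (∀ i y, g (toBohr _ (AlgPushout.of φ i y)) = f i y) ∧
      ∀ x, g (toBohr _ (AlgPushout.base φ x)) = k x := by
  let F : AlgPushout φ →* K := Monoid.PushoutI.lift (fun i => (f i).toMonoidHom) k.toMonoidHom
    fun i => MonoidHom.ext (hf i)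
  have hof : ∀ i y, F (AlgPushout.of φ i y) = f i y := fun i y =>
    Monoid.PushoutI.lift_of _ _ _ _
  have hbase : ∀ x, F (AlgPushout.base φ x) = k x := fun x =>
    Monoid.PushoutI.lift_base _ _ _ _
  have hF : Continuous F := by
    rw [continuous_iff_le_induced, AlgPushout.topology_eq φ]
    refine sInf_le ⟨⟨TopologicalSpace.induced F inferInstance, topologicalGroup_induced F⟩,
      ⟨fun i => continuous_induced_rng.mpr ?_, continuous_induced_rng.mpr ?_⟩, rfl⟩
    · exact (f i).continuous_toFun.congr fun y => (hof i y).symm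
    · exact k.continuous_toFun.congr fun x => (hbase x).symm
  obtain ⟨g, hg, huniq⟩ := bohr_existsUnique (⟨F, hF⟩ : AlgPushout φ →ₜ* K)
  refine ⟨g, ⟨fun i y => (hg _).trans (hof i y), fun x => (hg _).trans (hbase x)⟩, ?_⟩
  rintro g' ⟨h1, h2⟩
  apply huniq
  have : g'.toMonoidHom.comp (toBohr (AlgPushout φ)).toMonoidHom = F :=
    Monoid.PushoutI.hom_ext
      (fun i => MonoidHom.ext fun y => (h1 i y).trans (hof i y).symm)
      (MonoidHom.ext fun x => (h2 x).trans (hbase x).symm)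
  exact fun x => DFunLike.congr_fun this x

/-- The canonical map from the algebraic multi-pushout to the compact-group multi-pushout
is one-to-one. -/
def AlgebraicallySound : Prop :=
  Function.Injective (toBohr (AlgPushout φ))

/-- There are embeddings of all the `G i` into one compact group that agree on `H`. -/
def CoherentlyEmbeddable : Prop :=
  ∃ (K : Type u) (_ : Group K) (_ : TopologicalSpace K) (_ : IsTopologicalGroup K)
    (_ : CompactSpace K) (_ : T2Space K) (j : ∀ i, G i →ₜ* K),
    (∀ i, Function.Injective (j i)) ∧ ∀ i i' x, j i (φ i x) = j i' (φ i' x)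

end Pushout

end CompactAmalgam

/-! If the canonical map to the compact pushout is injective, that pushout is itself a coherent
embedding, since each `G i` embeds in the algebraic amalgam. Conversely, let `γ` be killed in the
Bohr compactification and write `γ = h * w`, with `h` from `H` and `w` a reduced word whose letters
lie outside the images of `H` (`exists_base_mul_reduced`). By the universal property every
compatible family of morphisms to a compact group kills `γ`. If `w` is nonempty, normality lets one
work modulo `H`: finite-dimensional orthogonal representations of the `G i`, trivial on `H`, are
built on one common space so that `w` acts nontrivially (`exists_rep_prod_ne_one`), a contradiction.
So `γ = h`, and a coherent embedding, being injective on `H`, forces `h = 1`. The representations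
come from Peter–Weyl (`exists_orthogonal_rep_ne_one`), applied to each quotient by the image of `H`.
They are glued one letter at a time, each new letter pushing a chosen vector into a fresh summand
(`exists_rep_wordAct_ne_zero`). -/

namespace CompactAmalgam

open MeasureTheory Topology Filter

/-! ### Compact operators given by continuous kernels -/

section Kernel
variable {X E : Type*} [TopologicalSpace X] [CompactSpace X] [NormedAddCommGroup E]
  [InnerProductSpace ℝ E]

/-- The operator `E → C(X, ℝ)` sending `v` to the function `x ↦ ⟪c x, v⟫`. -/
noncomputable def innerKernel (c : C(X, E)) : E →L[ℝ] C(X, ℝ) :=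
  LinearMap.mkContinuous
    { toFun := fun v => ⟨fun x => inner ℝ (c x) v, by fun_prop⟩
      map_add' := fun v w => ContinuousMap.ext fun x => inner_add_right _ _ _
      map_smul' := fun a v => ContinuousMap.ext fun x => real_inner_smul_right _ _ _ } ‖c‖ fun v => by
    refine (ContinuousMap.norm_le _ (by positivity)).2 fun x => ?_
    exact (norm_inner_le_norm _ _).trans
      (mul_le_mul_of_nonneg_right (c.norm_coe_le_norm x) (norm_nonneg v))

@[simp]
theorem innerKernel_apply (c : C(X, E)) (v : E) (x : X) : innerKernel c v x = inner ℝ (c x) v :=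
  rfl

/-- Arzelà–Ascoli: by Cauchy–Schwarz the images of unit vectors are bounded by `‖c‖` and inherit a
common modulus of continuity from `c`. -/
theorem isCompactOperator_innerKernel (c : C(X, E)) : IsCompactOperator (innerKernel c) := by
  let J := ContinuousMap.linearIsometryBoundedOfCompact X ℝ ℝ
  have key : IsCompactOperator (J.toContinuousLinearEquiv.toContinuousLinearMap ∘L innerKernel c) := by
    refine (isCompactOperator_iff_isCompact_closure_image_ball
      (J.toContinuousLinearEquiv.toContinuousLinearMap ∘L innerKernel c).toLinearMap one_pos).2 ?_
    refine BoundedContinuousFunction.arzela_ascoli (Metric.closedBall 0 ‖c‖)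
      (isCompact_closedBall _ _) _ ?_ ?_
    · rintro _ x ⟨v, hv, rfl⟩
      rw [mem_closedBall_zero_iff]
      have hv' : ‖v‖ ≤ 1 := (mem_ball_zero_iff.1 hv).le
      change ‖inner ℝ (c x) v‖ ≤ _
      refine (norm_inner_le_norm _ _).trans ?_
      calc _ ≤ ‖c‖ * 1 := mul_le_mul (c.norm_coe_le_norm x) hv' (norm_nonneg _) (norm_nonneg _)
        _ = _ := mul_one _
    · refine fun x₀ => Metric.equicontinuousAt_iff_right.2 fun ε hε => ?_
      filter_upwards [Metric.continuousAt_iff'.1 (c.continuous.continuousAt (x := x₀)) ε hε]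
      rintro x hx ⟨_, v, hv, rfl⟩
      have hv' : ‖v‖ ≤ 1 := (mem_ball_zero_iff.1 hv).le
      change dist (inner ℝ (c x₀) v) (inner ℝ (c x) v) < ε
      rw [dist_eq_norm, ← inner_sub_left]
      refine (norm_inner_le_norm _ _).trans_lt ?_
      rw [dist_comm, dist_eq_norm] at hx
      calc _ ≤ ‖c x₀ - c x‖ * 1 := mul_le_mul_of_nonneg_left hv' (norm_nonneg _)
        _ < ε := by rwa [mul_one]
  obtain ⟨K, hK, hK0⟩ := key
  refine ⟨J.symm '' K, hK.image J.symm.continuous, Filter.mem_of_superset hK0 fun v hv => ?_⟩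
  exact ⟨_, hv, J.symm_apply_apply _⟩

end Kernel

/-- Take `k` supported in a neighbourhood `U` of `1` with `g ∉ U * U * U⁻¹`. If all three values
were nonzero, then `g = x * (x⁻¹ * y) * (g⁻¹ * y)⁻¹` would lie in that set. -/
theorem exists_bump {G : Type*} [Group G] [TopologicalSpace G]
    [IsTopologicalGroup G] [CompactSpace G] [T2Space G] {g : G} (hg : g ≠ 1) :
    ∃ k : C(G, ℝ), (∀ x, k x⁻¹ = k x) ∧ (∀ x, 0 ≤ k x) ∧
    0 < k 1 ∧ ∀ x y, k x ≠ 0 → k (g⁻¹ * y) ≠ 0 → k (x⁻¹ * y) = 0 := by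
  obtain ⟨U, hU, hU1, hUg⟩ : ∃ U : Set G, IsOpen U ∧ (1 : G) ∈ U ∧
      ∀ x ∈ U, ∀ y ∈ U, ∀ z ∈ U, x * y * z⁻¹ ≠ g := by
    have hc : Tendsto (fun p : G × G × G => p.1 * p.2.1 * p.2.2⁻¹) (𝓝 1 ×ˢ 𝓝 1 ×ˢ 𝓝 1) (𝓝 1) := by
      rw [← nhds_prod_eq, ← nhds_prod_eq]
      refine ContinuousAt.tendsto (x := ((1, 1, 1) : G × G × G)) (by fun_prop) |>.trans (by simp)
    obtain ⟨V, hV, W, hW, h⟩ := Filter.mem_prod_iff.1 (hc (isOpen_ne.mem_nhds hg.symm))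
    obtain ⟨W1, hW1, W2, hW2, h'⟩ := Filter.mem_prod_iff.1 hW
    obtain ⟨U, hUs, hU, hU1⟩ := mem_nhds_iff.1 (inter_mem hV (inter_mem hW1 hW2))
    refine ⟨U, hU, hU1, fun x hx y hy z hz => ?_⟩
    exact h (show (x, y, z) ∈ V ×ˢ W from ⟨(hUs hx).1, h' ⟨(hUs hy).2.1, (hUs hz).2.2⟩⟩)
  obtain ⟨f, hf0, hf1, hf⟩ := exists_continuous_zero_one_of_isClosed hU.isClosed_compl
    (isClosed_singleton (x := (1 : G))) (by simpa using hU1)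
  have hfU : ∀ x, f x * f x⁻¹ ≠ 0 → x ∈ U := fun x hx => by
    by_contra h
    exact hx (by rw [hf0 h]; simp)
  refine ⟨⟨fun x => f x * f x⁻¹, by fun_prop⟩, fun x => by simp [mul_comm],
    fun x => mul_nonneg (hf x).1 (hf _).1, ?_, fun x y hx hy => ?_⟩
  · have := hf1 (Set.mem_singleton 1)
    simp [this]
  · by_contra hxy
    refine hUg x (hfU _ hx) _ (hfU _ hxy) _ (hfU _ hy) ?_
    group

/-! ### Peter–Weyl: convolution operators and left translations on `L²` -/

section Convolution
variable {G : Type*} [Group G] [TopologicalSpace G] [IsTopologicalGroup G] [CompactSpace G]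
  [MeasurableSpace G] [BorelSpace G]

/-- Real square-integrable functions for the Haar measure. -/
noncomputable abbrev HaarL2 (G : Type*) [Group G] [TopologicalSpace G] [IsTopologicalGroup G]
    [CompactSpace G] [MeasurableSpace G] [BorelSpace G] := Lp ℝ 2 (Measure.haar : Measure G)

/-- The inclusion of continuous functions into square-integrable functions. -/
noncomputable abbrev toL2 : C(G, ℝ) →L[ℝ] HaarL2 G := ContinuousMap.toLp 2 Measure.haar ℝ

theorem denseRange_toL2 : DenseRange (toL2 (G := G)) :=
  ContinuousMap.toLp_denseRange ℝ _ _ (by simp)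

theorem inner_toL2 (f h : C(G, ℝ)) : inner ℝ (toL2 f) (toL2 h) = ∫ x, f x * h x ∂Measure.haar := by
  rw [ContinuousMap.inner_toLp]
  simp [mul_comm]

/-- The translates `y ↦ k (x⁻¹ * y)` as a continuous family of square-integrable functions. -/
noncomputable def translates (k : C(G, ℝ)) : C(G, HaarL2 G) :=
  (⟨toL2, toL2.continuous⟩ : C(C(G, ℝ), HaarL2 G)).comp
    (ContinuousMap.curry ⟨fun p : G × G => k (p.1⁻¹ * p.2), by fun_prop⟩)

/-- The convolution operator with kernel `k (x⁻¹ * y)`. -/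
noncomputable def convOp (k : C(G, ℝ)) : HaarL2 G →L[ℝ] HaarL2 G :=
  toL2 ∘L innerKernel (translates k)

theorem isCompactOperator_convOp (k : C(G, ℝ)) : IsCompactOperator (convOp k) :=
  (isCompactOperator_innerKernel _).clm_comp toL2

theorem innerKernel_translates_toL2 (k f : C(G, ℝ)) (x : G) :
    innerKernel (translates k) (toL2 f) x = ∫ y, k (x⁻¹ * y) * f y ∂Measure.haar :=
  inner_toL2 _ _

theorem inner_convOp_toL2 (k f h : C(G, ℝ)) : inner ℝ (convOp k (toL2 f)) (toL2 h) =
    ∫ x, ∫ y, k (x⁻¹ * y) * f y * h x ∂Measure.haar ∂Measure.haar := by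
  rw [convOp, ContinuousLinearMap.comp_apply, inner_toL2]
  simp_rw [innerKernel_translates_toL2, integral_mul_const]

/-- By density it suffices to test continuous functions, where this is Fubini together with `k (x⁻¹
* y) = k (y⁻¹ * x)`. -/
theorem isSymmetric_convOp (k : C(G, ℝ)) (hk : ∀ x, k x⁻¹ = k x) :
    (convOp k : HaarL2 G →ₗ[ℝ] HaarL2 G).IsSymmetric := by
  intro u v
  refine denseRange_toL2.induction_on₂
    (p := fun u v => inner ℝ (convOp k u) v = inner ℝ u (convOp k v))
    (isClosed_eq (by fun_prop) (by fun_prop)) (fun f h => ?_) u v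
  rw [real_inner_comm (convOp k (toL2 h)), inner_convOp_toL2, inner_convOp_toL2,
    integral_integral_swap_of_hasCompactSupport (by fun_prop) (HasCompactSupport.of_compactSpace _)]
  refine integral_congr_ae (.of_forall fun y => integral_congr_ae (.of_forall fun x => ?_))
  have : k (x⁻¹ * y) = k (y⁻¹ * x) := by rw [← hk]; simp
  simp only [this]
  ring

/-- Left translation on square-integrable functions. -/
noncomputable def leftTranslation (g : G) : HaarL2 G →ₗᵢ[ℝ] HaarL2 G :=
  Lp.compMeasurePreservingₗᵢ ℝ (g⁻¹ * ·) (measurePreserving_mul_left Measure.haar g⁻¹)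

theorem leftTranslation_toL2 (g : G) (f : C(G, ℝ)) :
    leftTranslation g (toL2 f) = toL2 (f.comp ⟨(g⁻¹ * ·), by fun_prop⟩) :=
  rfl

theorem leftTranslation_mul (g h : G) (v : HaarL2 G) :
    leftTranslation (g * h) v = leftTranslation g (leftTranslation h v) := by
  refine denseRange_toL2.induction_on
    (p := fun v => leftTranslation (g * h) v = leftTranslation g (leftTranslation h v)) v
    (isClosed_eq (leftTranslation _).continuous
      ((leftTranslation _).continuous.comp (leftTranslation _).continuous)) fun f => ?_
  simp only [leftTranslation_toL2]
  congr 1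
  ext x
  simp [mul_assoc]

theorem leftTranslation_one (v : HaarL2 G) : leftTranslation 1 v = v := by
  refine denseRange_toL2.induction_on (p := fun v => leftTranslation 1 v = v) v
    (isClosed_eq (leftTranslation _).continuous continuous_id) fun f => ?_
  rw [leftTranslation_toL2]
  congr 1
  ext x
  simp

theorem continuous_leftTranslation (v : HaarL2 G) : Continuous fun g : G => leftTranslation g v :=
  continuous_const.compMeasurePreservingLp (f := fun _ => v)
    (g := ContinuousMap.curry ⟨fun p : G × G => p.1⁻¹ * p.2, by fun_prop⟩)
    (ContinuousMap.continuous _)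
    (fun g => measurePreserving_mul_left Measure.haar g⁻¹) (by simp)

theorem convOp_leftTranslation (k : C(G, ℝ)) (g : G) (v : HaarL2 G) :
    convOp k (leftTranslation g v) = leftTranslation g (convOp k v) := by
  refine denseRange_toL2.induction_on
    (p := fun v => convOp k (leftTranslation g v) = leftTranslation g (convOp k v)) v
    (isClosed_eq ((convOp k).continuous.comp (leftTranslation _).continuous)
      ((leftTranslation _).continuous.comp (convOp k).continuous)) fun f => ?_
  rw [leftTranslation_toL2, convOp, ContinuousLinearMap.comp_apply, ContinuousLinearMap.comp_apply,
    leftTranslation_toL2]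
  congr 1
  ext x
  simp only [innerKernel_translates_toL2, ContinuousMap.comp_apply, ContinuousMap.coe_mk]
  -- Left invariance of Haar measure: substitute `g * y` for `y`.
  rw [← integral_mul_left_eq_self _ g]
  simp [mul_assoc]

/-- Take `v = k`, the bump function. Pairing with `k`, the translated side has an identically zero
integrand, while the untranslated side is the integral of a nonnegative function that is positive at
`x = y = 1`. -/
theorem exists_convOp_leftTranslation_ne [T2Space G] {g : G} (hg : g ≠ 1) : ∃ k : C(G, ℝ),
    (∀ x, k x⁻¹ = k x) ∧ ∃ v : HaarL2 G, convOp k (leftTranslation g v) ≠ convOp k v := by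
  obtain ⟨k, hk, hk0, hk1, hkg⟩ := exists_bump hg
  refine ⟨k, hk, toL2 k, fun h => ?_⟩
  have h0 : inner ℝ (convOp k (leftTranslation g (toL2 k))) (toL2 k) = 0 := by
    rw [leftTranslation_toL2, inner_convOp_toL2]
    refine integral_eq_zero_of_ae (.of_forall fun x =>
      integral_eq_zero_of_ae (.of_forall fun y => ?_))
    by_cases hx : k x = 0
    · simp [hx]
    by_cases hy : k (g⁻¹ * y) = 0
    · simp [hy]
    · simp [hkg x y hx hy]
  rw [h, inner_convOp_toL2] at h0
  have hc : Continuous fun x => ∫ y, k (x⁻¹ * y) * k y * k x ∂Measure.haar := by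
    simp_rw [integral_mul_const, ← innerKernel_translates_toL2]
    fun_prop
  have hn : ∀ x y, 0 ≤ k (x⁻¹ * y) * k y * k x := fun x y =>
    mul_nonneg (mul_nonneg (hk0 _) (hk0 _)) (hk0 _)
  have hpos : 0 < ∫ y, k ((1 : G)⁻¹ * y) * k y * k 1 ∂Measure.haar :=
    Continuous.integral_pos_of_hasCompactSupport_nonneg_nonzero (x := (1 : G)) (by fun_prop)
      (HasCompactSupport.of_compactSpace _) (hn 1) (by simp [hk1.ne'])
  exact (Continuous.integral_pos_of_hasCompactSupport_nonneg_nonzero (x := (1 : G)) hc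
      (HasCompactSupport.of_compactSpace _) (fun x => integral_nonneg (hn x)) hpos.ne').ne' h0

/-- If `g` fixed every eigenvector with nonzero eigenvalue, then `convOp k` and its composite with
translation by `g` would agree on all eigenspaces, hence everywhere by the spectral theorem for
compact symmetric operators. -/
theorem exists_eigenvector_leftTranslation_ne [T2Space G] {g : G} (hg : g ≠ 1) :
    ∃ k : C(G, ℝ), ∃ c : ℝ, c ≠ 0 ∧ ∃ v : HaarL2 G, convOp k v = c • v ∧ leftTranslation g v ≠ v := by
  obtain ⟨k, hk, v, hv⟩ := exists_convOp_leftTranslation_ne hg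
  refine ⟨k, ?_⟩
  by_contra! H
  let S : Submodule ℝ (HaarL2 G) := LinearMap.eqLocus
    ((convOp k).toLinearMap ∘ₗ (leftTranslation g).toLinearMap) (convOp k).toLinearMap
  have hS : IsClosed (S : Set (HaarL2 G)) :=
    isClosed_eq ((convOp k).continuous.comp (leftTranslation g).continuous) (convOp k).continuous
  have hle : (⨆ c, Module.End.eigenspace (convOp k : Module.End ℝ (HaarL2 G)) c) ≤ S := by
    refine iSup_le fun c w hw => ?_
    rw [Module.End.mem_eigenspace_iff] at hw
    change convOp k w = c • w at hw
    change convOp k (leftTranslation g w) = convOp k w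
    by_cases hc : c = 0
    -- The kernel may be moved by `g`, but it is translation-invariant, so both sides vanish.
    · rw [convOp_leftTranslation, hw, hc, zero_smul, map_zero]
    · rw [H c hc w hw]
  have hbot := ContinuousLinearMap.orthogonalComplement_iSup_eigenspaces_eq_bot
    (isCompactOperator_convOp k) (isSymmetric_convOp k hk)
  have htop : S = ⊤ := by
    rw [← hS.submodule_topologicalClosure_eq, ← top_le_iff,
      ← Submodule.topologicalClosure_eq_top_iff.2 hbot]
    exact Submodule.topologicalClosure_mono hle
  exact hv (htop ▸ Submodule.mem_top : v ∈ S)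

/-- Every nontrivial element of a compact Hausdorff group acts nontrivially in some
finite-dimensional orthogonal representation. -/
theorem exists_orthogonal_rep_ne_one {G : Type*} [Group G] [TopologicalSpace G]
    [IsTopologicalGroup G] [CompactSpace G] [T2Space G] {g : G} (hg : g ≠ 1) :
    ∃ (n : ℕ) (ρ : G →ₜ* Matrix.unitaryGroup (Fin n) ℝ), ρ g ≠ 1 := by
  borelize G
  obtain ⟨k, c, hc, v, hv, hgv⟩ := exists_eigenvector_leftTranslation_ne hg
  -- The eigenspace is finite-dimensional because `c ≠ 0`, and invariant because convolution
  -- commutes with translations; `M` is the matrix of the action on it.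
  let E := Module.End.eigenspace (convOp k : Module.End ℝ (HaarL2 G)) c
  have : FiniteDimensional ℝ E :=
    ContinuousLinearMap.finite_dimensional_eigenspace (isCompactOperator_convOp k) c hc
  have hmem : ∀ w, w ∈ E ↔ convOp k w = c • w := fun w => Module.End.mem_eigenspace_iff
  have hE : ∀ h, ∀ w ∈ E, leftTranslation h w ∈ E := fun h w hw => by
    rw [hmem] at hw ⊢
    rw [convOp_leftTranslation, hw, map_smul]
  let b := stdOrthonormalBasis ℝ E
  let M : G → Matrix (Fin (Module.finrank ℝ E)) (Fin (Module.finrank ℝ E)) ℝ := fun h =>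
    .of fun i j => inner ℝ (b i : HaarL2 G) (leftTranslation h (b j))
  have hexp : ∀ h (w : E), leftTranslation h (w : HaarL2 G) =
      ∑ i, inner ℝ (b i : HaarL2 G) (leftTranslation h w) • (b i : HaarL2 G) := fun h w => by
    have := congrArg Subtype.val (b.sum_repr' ⟨_, hE h w w.2⟩)
    simpa using this.symm
  have hone : M 1 = 1 := by
    ext i j
    have := b.inner_eq_ite i j
    simpa [M, leftTranslation_one, Matrix.one_apply] using this
  have hmul : ∀ h h', M (h * h') = M h * M h' := fun h h' => by
    ext i j
    simp only [M, Matrix.of_apply, Matrix.mul_apply, leftTranslation_mul]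
    conv_lhs => rw [hexp h' (b j), map_sum, inner_sum]
    refine Finset.sum_congr rfl fun l _ => ?_
    rw [map_smul, real_inner_smul_right, mul_comm]
  have hinv : ∀ h, star (M h) = M h⁻¹ := fun h => by
    ext i j
    rw [Matrix.star_apply]
    simp only [M, Matrix.of_apply, star_trivial]
    rw [← (leftTranslation h).inner_map_map (b i) _, ← leftTranslation_mul, mul_inv_cancel,
      leftTranslation_one, real_inner_comm]
  let ρ : G →ₜ* Matrix.unitaryGroup (Fin (Module.finrank ℝ E)) ℝ :=
    { toFun := fun h => ⟨M h, by
        rw [Matrix.mem_unitaryGroup_iff, hinv, ← hmul, mul_inv_cancel, hone]⟩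
      map_one' := Subtype.ext hone
      map_mul' := fun h h' => Subtype.ext (hmul h h')
      continuous_toFun := by
        refine Continuous.subtype_mk (continuous_matrix fun i j => ?_) _
        exact continuous_const.inner (continuous_leftTranslation _) }
  refine ⟨_, ρ, fun h => hgv ?_⟩
  have hM : M g = 1 := congrArg Subtype.val h
  have hb : ∀ j, leftTranslation g (b j : HaarL2 G) = b j := fun j => by
    rw [hexp]
    have : ∀ i, inner ℝ (b i : HaarL2 G) (leftTranslation g (b j)) =
      (1 : Matrix (Fin (Module.finrank ℝ E)) (Fin (Module.finrank ℝ E)) ℝ) i j :=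
      fun i => congrFun (congrFun hM i) j
    simp [this, Matrix.one_apply]
  have hve := congrArg Subtype.val (b.sum_repr ⟨v, (hmem v).2 hv⟩)
  rw [AddSubmonoidClass.coe_finsetSum] at hve
  change _ = v at hve
  rw [← hve, map_sum]
  simp [hb]

end Convolution

/-! ### Doubling a matrix to make nontriviality visible off the diagonal -/

section DoubleMatrix
variable {X : Type*} [DecidableEq X]

/-- The matrix of `M ⊕ 1` in a basis in which it is diagonal only for `M = 1`. -/
noncomputable def doubleMatrix (M : Matrix X X ℝ) : Matrix (X ⊕ X) (X ⊕ X) ℝ :=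
  (2⁻¹ : ℝ) • Matrix.fromBlocks (M + 1) (M - 1) (M - 1) (M + 1)

theorem continuous_doubleMatrix : Continuous (doubleMatrix (X := X)) :=
  have h1 : Continuous fun M : Matrix X X ℝ => M + 1 := by fun_prop
  have h2 : Continuous fun M : Matrix X X ℝ => M - 1 := by fun_prop
  (h1.matrix_fromBlocks h2 h2 h1).const_smul (2⁻¹ : ℝ)

theorem doubleMatrix_one : doubleMatrix (1 : Matrix X X ℝ) = 1 := by
  rw [doubleMatrix, Matrix.fromBlocks_smul, ← Matrix.fromBlocks_one]
  congr 1 <;> module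

theorem star_doubleMatrix (M : Matrix X X ℝ) : star (doubleMatrix M) = doubleMatrix (star M) := by
  simp only [doubleMatrix, Matrix.star_eq_conjTranspose, Matrix.conjTranspose_smul,
    Matrix.fromBlocks_conjTranspose, Matrix.conjTranspose_add, Matrix.conjTranspose_sub,
    Matrix.conjTranspose_one, star_trivial]

theorem doubleMatrix_mul [Fintype X] (M M' : Matrix X X ℝ) :
    doubleMatrix (M * M') = doubleMatrix M * doubleMatrix M' := by
  simp only [doubleMatrix, Matrix.smul_mul, Matrix.mul_smul, Matrix.fromBlocks_multiply,
    Matrix.fromBlocks_smul, mul_add, add_mul, mul_sub, sub_mul, mul_one, one_mul]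
  congr 1 <;> module

end DoubleMatrix

/-! ### Constructions on orthogonal representations -/

section Representations
variable {G X B : Type*} [Group G] [TopologicalSpace G] [Fintype X] [DecidableEq X] [Fintype B]
  [DecidableEq B]

instance compactSpace_unitaryGroup : CompactSpace (Matrix.unitaryGroup X ℝ) := by
  suffices IsCompact (Matrix.unitaryGroup X ℝ : Set (Matrix X X ℝ)) from
    isCompact_iff_compactSpace.1 this
  have hcl : IsClosed (Matrix.unitaryGroup X ℝ : Set (Matrix X X ℝ)) := isClosed_unitary
  refine (isCompact_univ_pi fun _ : X => isCompact_univ_pi fun _ : X =>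
    isCompact_Icc (a := (-1 : ℝ)) (b := 1)).of_isClosed_subset hcl ?_
  intro A hA i _ j _
  exact abs_le.1 (entry_norm_bound_of_unitary hA i j)

/-- An orthogonal representation from a multiplicative family of orthogonal matrices. -/
def orthogonalRep (f : G → Matrix X X ℝ) (hf : Continuous f) (hmul : ∀ g h, f (g * h) = f g * f h)
    (hu : ∀ g, f g ∈ Matrix.unitaryGroup X ℝ) : G →ₜ* Matrix.unitaryGroup X ℝ where
  __ := MonoidHom.mk' (fun g => (⟨f g, hu g⟩ : Matrix.unitaryGroup X ℝ))
    fun g h => Subtype.ext (hmul g h)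
  continuous_toFun := hf.subtype_mk _

/-- The direct sum of two orthogonal representations. -/
def directSumRep (ρ : G →ₜ* Matrix.unitaryGroup X ℝ) (τ : G →ₜ* Matrix.unitaryGroup B ℝ) :
    G →ₜ* Matrix.unitaryGroup (X ⊕ B) ℝ :=
  orthogonalRep (fun g => Matrix.fromBlocks (ρ g) 0 0 (τ g))
    (Continuous.matrix_fromBlocks (continuous_subtype_val.comp ρ.continuous_toFun)
      continuous_const continuous_const (continuous_subtype_val.comp τ.continuous_toFun))
    (fun g h => by simp [Matrix.fromBlocks_multiply])
    (fun g => by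
      have h1 := Matrix.mem_unitaryGroup_iff.1 (ρ g).2
      have h2 := Matrix.mem_unitaryGroup_iff.1 (τ g).2
      rw [Matrix.star_eq_conjTranspose] at h1 h2
      rw [Matrix.mem_unitaryGroup_iff, Matrix.star_eq_conjTranspose, Matrix.fromBlocks_conjTranspose,
        Matrix.fromBlocks_multiply, h1, h2]
      simp)

/-- An orthogonal representation with its basis vectors permuted. -/
def permuteRep (σ : Equiv.Perm X) (ρ : G →ₜ* Matrix.unitaryGroup X ℝ) :
    G →ₜ* Matrix.unitaryGroup X ℝ :=
  orthogonalRep (fun g => (ρ g : Matrix X X ℝ).submatrix σ σ)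
    ((continuous_subtype_val.comp ρ.continuous_toFun).matrix_submatrix _ _)
    (fun g h => by simp [Matrix.submatrix_mul_equiv])
    (fun g => by
      have h1 := Matrix.mem_unitaryGroup_iff.1 (ρ g).2
      rw [Matrix.star_eq_conjTranspose] at h1
      rw [Matrix.mem_unitaryGroup_iff, Matrix.star_eq_conjTranspose, Matrix.conjTranspose_submatrix,
        Matrix.submatrix_mul_equiv, h1, Matrix.submatrix_one_equiv])

/-- The sum of an orthogonal representation and a trivial one of the same dimension, in a basis
in which it is diagonal only where the given representation is trivial. -/
noncomputable def doubleRep (ρ : G →ₜ* Matrix.unitaryGroup X ℝ) :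
    G →ₜ* Matrix.unitaryGroup (X ⊕ X) ℝ :=
  orthogonalRep (fun g => doubleMatrix (ρ g : Matrix X X ℝ))
    (continuous_doubleMatrix.comp (continuous_subtype_val.comp ρ.continuous_toFun))
    (fun g h => by simp [doubleMatrix_mul])
    (fun g => by
      rw [Matrix.mem_unitaryGroup_iff, star_doubleMatrix, ← doubleMatrix_mul,
        Matrix.mem_unitaryGroup_iff.1 (ρ g).2, doubleMatrix_one])

theorem doubleRep_eq_one {ρ : G →ₜ* Matrix.unitaryGroup X ℝ} {g : G} (h : ρ g = 1) :
    doubleRep ρ g = 1 := by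
  refine Subtype.ext ?_
  change doubleMatrix (ρ g : Matrix X X ℝ) = 1
  rw [h]
  exact doubleMatrix_one

/-- The off-diagonal block is `(ρ g - 1) / 2`. Without doubling this can fail, as for `ρ g = -1`. -/
theorem exists_doubleRep_apply_ne_zero {ρ : G →ₜ* Matrix.unitaryGroup X ℝ} {g : G} (h : ρ g ≠ 1) :
    ∃ a b, a ≠ b ∧ (doubleRep ρ g : Matrix (X ⊕ X) (X ⊕ X) ℝ) a b ≠ 0 := by
  by_contra! H
  refine h (Subtype.ext (Matrix.ext fun i j => ?_))
  have : 2⁻¹ * ((ρ g : Matrix X X ℝ) i j - (1 : Matrix X X ℝ) i j) = 0 :=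
    H (.inl i) (.inr j) (by simp)
  change (ρ g : Matrix X X ℝ) i j = (1 : Matrix X X ℝ) i j
  linarith

end Representations

/-! ### Gluing representations along a reduced word -/

section Words
variable {ι : Type*} {G : ι → Type*} [∀ i, Group (G i)] [∀ i, TopologicalSpace (G i)]
  {X B : Type*} [Fintype X] [DecidableEq X] [Fintype B] [DecidableEq B]

open Matrix

/-- The result of applying a word of group elements to a vector. -/
def wordAct (ρ : ∀ i, G i →ₜ* unitaryGroup X ℝ) (l : List (Σ i, G i)) (v : X → ℝ) : X → ℝ :=
  l.foldr (fun a v => (ρ a.1 a.2 : Matrix X X ℝ) *ᵥ v) v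

theorem wordAct_eq (ρ : ∀ i, G i →ₜ* unitaryGroup X ℝ) (l : List (Σ i, G i)) (v : X → ℝ) :
    wordAct ρ l v = ((l.map fun a => ρ a.1 a.2).prod : unitaryGroup X ℝ).1 *ᵥ v := by
  induction l with
  | nil => simp [wordAct]
  | cons a l ih =>
    change (ρ a.1 a.2 : Matrix X X ℝ) *ᵥ wordAct ρ l v = _
    simp [ih]

open Classical in
/-- The free combination of a family of representations with a representation `τ` of `G i`: the
trivial extension for the indices other than `i`, and for `i` the direct sum with the basis vectors
`f` and `e` exchanged. -/
noncomputable def graftRep (ρ : ∀ i, G i →ₜ* unitaryGroup X ℝ) (i : ι)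
    (τ : G i →ₜ* unitaryGroup B ℝ) (f : X) (e : B) (j : ι) : G j →ₜ* unitaryGroup (X ⊕ B) ℝ :=
  if h : j = i then permuteRep (Equiv.swap (.inl f) (.inr e)) (directSumRep (ρ j) (h ▸ τ))
  else directSumRep (ρ j) ⟨1, continuous_const⟩

variable (ρ : ∀ i, G i →ₜ* unitaryGroup X ℝ) (i : ι) (τ : G i →ₜ* unitaryGroup B ℝ) (f : X) (e : B)

theorem graftRep_mulVec_same (g : G i) (v : X ⊕ B → ℝ) :
    (graftRep ρ i τ f e i g : Matrix (X ⊕ B) (X ⊕ B) ℝ) *ᵥ v =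
      (fromBlocks (ρ i g : Matrix X X ℝ) 0 0 (τ g : Matrix B B ℝ) *ᵥ
        (v ∘ Equiv.swap (.inl f) (.inr e))) ∘ Equiv.swap (.inl f) (.inr e) := by
  have : (graftRep ρ i τ f e i g : Matrix (X ⊕ B) (X ⊕ B) ℝ) =
      (fromBlocks (ρ i g : Matrix X X ℝ) 0 0 (τ g : Matrix B B ℝ)).submatrix
        (Equiv.swap (.inl f) (.inr e)) (Equiv.swap (.inl f) (.inr e)) := by
    simp only [graftRep, dif_pos]
    rfl
  rw [this, submatrix_mulVec_equiv]
  simp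

theorem graftRep_mulVec_of_ne {j : ι} (hj : j ≠ i) (g : G j) (x : X → ℝ) (y : B → ℝ) :
    (graftRep ρ i τ f e j g : Matrix (X ⊕ B) (X ⊕ B) ℝ) *ᵥ (Sum.elim x y) =
      Sum.elim ((ρ j g : Matrix X X ℝ) *ᵥ x) y := by
  have : (graftRep ρ i τ f e j g : Matrix (X ⊕ B) (X ⊕ B) ℝ) =
      fromBlocks (ρ j g : Matrix X X ℝ) 0 0 1 := by
    rw [graftRep, dif_neg hj]
    rfl
  rw [this, fromBlocks_mulVec]
  simp [Function.comp_def]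

/-- Both exchanged coordinates of the vector are zero, and remain so since `ρ i` preserves the
`f`-coordinate; the exchange is therefore invisible. -/
theorem graftRep_mulVec_inl {j : ι} (g : G j) (x : X → ℝ) (hx : x f = 0)
    (hf : ∀ a (v : X → ℝ), ((ρ i a : Matrix X X ℝ) *ᵥ v) f = v f) :
    (graftRep ρ i τ f e j g : Matrix (X ⊕ B) (X ⊕ B) ℝ) *ᵥ (Sum.elim x 0) =
      Sum.elim ((ρ j g : Matrix X X ℝ) *ᵥ x) 0 := by
  by_cases hj : j = i
  · subst hj
    have key : ∀ z : X → ℝ, z f = 0 → Sum.elim z (0 : B → ℝ) ∘ Equiv.swap (.inl f) (.inr e) =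
        Sum.elim z 0 := by
      intro z hz
      funext a
      by_cases h1 : a = .inl f
      · subst h1; simp [hz]
      by_cases h2 : a = .inr e
      · subst h2; simp [hz]
      · simp [Equiv.swap_apply_of_ne_of_ne h1 h2]
    rw [graftRep_mulVec_same, key x hx, fromBlocks_mulVec]
    simp only [Sum.elim_comp_inl, Sum.elim_comp_inr, zero_mulVec, mulVec_zero, add_zero]
    exact key _ ((hf g x).trans hx)
  · exact graftRep_mulVec_of_ne ρ i τ f e hj g x 0

/-- After the exchange, `f` plays the role of `e` in the representation space of `τ`, so a matrix
entry of `τ` carries the `f`-coordinate into the new summand. -/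
theorem graftRep_mulVec_inr (g : G i) (x : X → ℝ) {b : B} (hb : b ≠ e) :
    ((graftRep ρ i τ f e i g : Matrix (X ⊕ B) (X ⊕ B) ℝ) *ᵥ (Sum.elim x 0)) (.inr b) =
      (τ g : Matrix B B ℝ) b e * x f := by
  have h1 : Equiv.swap (Sum.inl f) (Sum.inr e) (.inr b) = (.inr b : X ⊕ B) :=
    Equiv.swap_apply_of_ne_of_ne (by simp) (by simpa using hb)
  rw [graftRep_mulVec_same, Function.comp_apply, h1, fromBlocks_mulVec, Sum.elim_inr]
  simp only [zero_mulVec, zero_add, mulVec, dotProduct]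
  rw [Finset.sum_eq_single e]
  · simp
  · intro c _ hc
    have h2 : Equiv.swap (Sum.inl f) (Sum.inr e) (.inr c) = (.inr c : X ⊕ B) :=
      Equiv.swap_apply_of_ne_of_ne (by simp) (by simpa using hc)
    simp [h2]
  · simp

theorem graftRep_eq_one {j : ι} {g : G j} (hg : ρ j g = 1)
    (hτ : ∀ h : j = i, τ (h ▸ g) = 1) : graftRep ρ i τ f e j g = 1 := by
  refine Subtype.ext ?_
  by_cases hj : j = i
  · subst hj
    have h1 := hτ rfl
    simp only at h1
    simp only [graftRep, dif_pos]
    change (fromBlocks (ρ j g : Matrix X X ℝ) 0 0 (τ g : Matrix B B ℝ)).submatrix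
        (Equiv.swap (.inl f) (.inr e)) (Equiv.swap (.inl f) (.inr e)) = 1
    rw [hg, h1]
    simp
  · rw [graftRep, dif_neg hj]
    change fromBlocks (ρ j g : Matrix X X ℝ) 0 0 1 = 1
    rw [hg]
    simp

/-- Induction on the word, letters acting from the right. The `f`-coordinate of the moving vector
stays zero until the last letter has acted, and only the group of that letter can alter the
`f`-coordinate of a vector. Thus `f` is free to serve as the entry point of a representation of the
next letter's group, whose index differs. -/
theorem exists_rep_wordAct_ne_zero (N : ∀ i, Set (G i))
    (hN : ∀ i, ∀ g ∉ N i, ∃ (n : ℕ) (ρ : G i →ₜ* unitaryGroup (Fin n) ℝ),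
      (∀ x ∈ N i, ρ x = 1) ∧ ρ g ≠ 1)
    (l : List (Σ i, G i)) (hl : l.IsChain fun a b => a.1 ≠ b.1) (hlN : ∀ a ∈ l, a.2 ∉ N a.1) :
    ∃ (X : Type) (_ : Fintype X) (_ : DecidableEq X) (ρ : ∀ i, G i →ₜ* unitaryGroup X ℝ) (e f : X),
      (∀ i, ∀ x ∈ N i, ρ i x = 1) ∧
      (∀ i, (∀ a ∈ l.head?, i ≠ a.1) → ∀ g (v : X → ℝ), ((ρ i g : Matrix X X ℝ) *ᵥ v) f = v f) ∧
      wordAct ρ l (Pi.single e 1) f ≠ 0 ∧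
      ∀ s, s <:+ l → s ≠ l → wordAct ρ s (Pi.single e 1) f = 0 := by
  induction l with
  | nil =>
    refine ⟨Unit, inferInstance, inferInstance, fun i => ⟨1, continuous_const⟩, (), (),
      fun _ _ _ => rfl, fun i _ g v => ?_, by simp [wordAct], fun s hs h => ?_⟩
    · change ((1 : Matrix Unit Unit ℝ) *ᵥ v) () = _
      simp
    · exact absurd (List.suffix_nil.1 hs) h
  | cons a l ih =>
    obtain ⟨i, g⟩ := a
    obtain ⟨X, _, _, ρ, e, f, hρ, hf, hw, hs⟩ :=
      ih hl.tail fun a ha => hlN a (List.mem_cons_of_mem _ ha)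
    have hfi : ∀ a (v : X → ℝ), ((ρ i a : Matrix X X ℝ) *ᵥ v) f = v f :=
      hf i fun a ha => (List.isChain_cons.1 hl).1 a ha
    obtain ⟨n, τ, hτ, hτg⟩ := hN i g (hlN ⟨i, g⟩ List.mem_cons_self)
    obtain ⟨f', e', hne, hτfe⟩ := exists_doubleRep_apply_ne_zero hτg
    -- The entry at `(f', e')` is nonzero for the new letter, so grafting at `e'` will send the
    -- `f`-coordinate to a nonzero `f'`-coordinate.
    let ρ' := graftRep ρ i (doubleRep τ) f e'
    -- Up to and including the whole of `l`, the vector moves as before inside the old space: each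
    -- letter meets a vector with zero `f`-coordinate.
    have hsuff : ∀ s, s <:+ l →
        wordAct ρ' s (Pi.single (.inl e) 1) = Sum.elim (wordAct ρ s (Pi.single e 1)) 0 := by
      intro s
      induction s with
      | nil =>
        intro _
        change Pi.single (.inl e) 1 = Sum.elim (Pi.single e 1) 0
        rw [Sum.elim_single_zero]
      | cons a s ih' =>
        intro hsl
        have h1 : s <:+ l := (List.suffix_cons a s).trans hsl
        have h2 : s ≠ l := fun h => by
          have := hsl.length_le
          simp [h] at this
        change (ρ' a.1 a.2 : Matrix (X ⊕ Fin n ⊕ Fin n) (X ⊕ Fin n ⊕ Fin n) ℝ) *ᵥ wordAct ρ' s _ = _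
        rw [ih' h1]
        exact graftRep_mulVec_inl ρ i _ f e' _ _ (hs s h1 h2) hfi
    refine ⟨X ⊕ (Fin n ⊕ Fin n), inferInstance, inferInstance, ρ', .inl e, .inr f', ?_, ?_, ?_, ?_⟩
    · intro j x hx
      refine graftRep_eq_one ρ i _ f e' (hρ j x hx) ?_
      rintro rfl
      exact doubleRep_eq_one (hτ x hx)
    · intro j hj x v
      have := graftRep_mulVec_of_ne ρ i (doubleRep τ) f e' (hj ⟨i, g⟩ rfl) x (v ∘ .inl) (v ∘ .inr)
      rw [Sum.elim_comp_inl_inr] at this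
      change ((graftRep ρ i (doubleRep τ) f e' j x : Matrix (X ⊕ Fin n ⊕ Fin n) (X ⊕ Fin n ⊕ Fin n) ℝ) *ᵥ v) _
        = _
      rw [this]
      rfl
    · change ((ρ' i g : Matrix (X ⊕ Fin n ⊕ Fin n) (X ⊕ Fin n ⊕ Fin n) ℝ) *ᵥ wordAct ρ' l _) _ ≠ 0
      rw [hsuff l List.suffix_rfl]
      change ((graftRep ρ i (doubleRep τ) f e' i g : Matrix (X ⊕ Fin n ⊕ Fin n) (X ⊕ Fin n ⊕ Fin n) ℝ) *ᵥ _) _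
        ≠ 0
      rw [graftRep_mulVec_inr _ _ _ _ _ _ _ hne]
      exact mul_ne_zero hτfe hw
    · intro s hsl hne'
      rcases List.suffix_cons_iff.1 hsl with h | h
      · exact absurd h hne'
      · rw [hsuff s h]
        rfl

/-- Words whose letters are nontrivial modulo `N` are separated from the identity by compatible
orthogonal representations. -/
theorem exists_rep_prod_ne_one (N : ∀ i, Set (G i))
    (hN : ∀ i, ∀ g ∉ N i, ∃ (n : ℕ) (ρ : G i →ₜ* unitaryGroup (Fin n) ℝ),
      (∀ x ∈ N i, ρ x = 1) ∧ ρ g ≠ 1)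
    (l : List (Σ i, G i)) (hl : l.IsChain fun a b => a.1 ≠ b.1) (hlN : ∀ a ∈ l, a.2 ∉ N a.1)
    (hne : l ≠ []) :
    ∃ (X : Type) (_ : Fintype X) (_ : DecidableEq X) (ρ : ∀ i, G i →ₜ* unitaryGroup X ℝ),
      (∀ i, ∀ x ∈ N i, ρ i x = 1) ∧ (l.map fun a => ρ a.1 a.2).prod ≠ 1 := by
  obtain ⟨X, _, _, ρ, e, f, hρ, -, hw, hs⟩ := exists_rep_wordAct_ne_zero N hN l hl hlN
  refine ⟨X, inferInstance, inferInstance, ρ, hρ, fun h => hw ?_⟩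
  -- The empty suffix says that the initial vector has zero `f`-coordinate, whereas the word makes
  -- it nonzero.
  have h0 := hs [] List.nil_suffix hne.symm
  rw [wordAct_eq, h, Submonoid.coe_one, one_mulVec]
  exact h0

end Words

/-- Apply Peter–Weyl to `G ⧸ N`, which is compact, and Hausdorff because `N` is closed. -/
theorem exists_orthogonal_rep_ne_one_of_notMem {G : Type*} [Group G] [TopologicalSpace G]
    [IsTopologicalGroup G] [CompactSpace G] (N : Subgroup G) [N.Normal] (hN : IsClosed (N : Set G))
    {g : G} (hg : g ∉ N) : ∃ (n : ℕ) (ρ : G →ₜ* Matrix.unitaryGroup (Fin n) ℝ),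
      (∀ x ∈ N, ρ x = 1) ∧ ρ g ≠ 1 := by
  have : IsClosed (N : Set G) := hN
  have hg' : (g : G ⧸ N) ≠ 1 := fun h => hg ((QuotientGroup.eq_one_iff g).1 h)
  obtain ⟨n, ρ, hρ⟩ := exists_orthogonal_rep_ne_one hg'
  refine ⟨n, ⟨ρ.toMonoidHom.comp (QuotientGroup.mk' N),
    ρ.continuous_toFun.comp QuotientGroup.continuous_mk⟩, fun x hx => ?_, hρ⟩
  change ρ (x : G ⧸ N) = 1
  rw [(QuotientGroup.eq_one_iff x).2 hx, map_one]

/-! ### Reduced words in the amalgam and the two implications -/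

section Pushout

variable {ι H : Type u} [Group H] [TopologicalSpace H] {G : ι → Type u} [∀ i, Group (G i)]
  [∀ i, TopologicalSpace (G i)] (φ : ∀ i, H →ₜ* G i)

open Monoid in
theorem exists_base_mul_reduced (hinj : ∀ i, Function.Injective (φ i)) (γ : AlgPushout φ) :
    ∃ (h : H) (w : CoprodI.Word G), (∀ a ∈ w.toList, a.2 ∉ (φ a.1).toMonoidHom.range) ∧
      γ = AlgPushout.base φ h * (w.toList.map fun a => AlgPushout.of φ a.1 a.2).prod := by
  classical
  let ψ : ∀ i, H →* G i := fun i => (φ i).toMonoidHom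
  obtain ⟨d⟩ := PushoutI.NormalWord.transversal_nonempty ψ hinj
  obtain ⟨w, rfl⟩ : ∃ w : PushoutI.NormalWord d, w.prod = γ :=
    ⟨PushoutI.NormalWord.equiv γ, PushoutI.NormalWord.equiv.symm_apply_apply γ⟩
  refine ⟨w.head, w.toWord, fun a ha hr => ?_, ?_⟩
  -- A letter of the normal form lies in the transversal. If it were also in the image of `H`,
  -- uniqueness of the factorization, applied to `a * 1 = 1 * a`, would make it `1`.
  · have hc := (d.compl a.1).1
    have h1 : a.2 * 1 = 1 * a.2 := by simp
    have h2 := @hc (⟨a.2, hr⟩, ⟨1, d.one_mem a.1⟩)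
      (⟨1, one_mem _⟩, ⟨a.2, w.normalized a.1 a.2 ha⟩) h1
    exact w.ne_one a ha (congrArg (fun p => (p.1 : G a.1)) h2)
  · rw [PushoutI.NormalWord.prod]
    congr 1
    rw [CoprodI.Word.prod, map_list_prod, List.map_map]
    rfl

variable {φ}

theorem map_eq_one_of_toBohr_eq_one {K : Type*} [Group K] [TopologicalSpace K]
    [IsTopologicalGroup K] [CompactSpace K] [T2Space K] (f : ∀ i, G i →ₜ* K) (k : H →ₜ* K)
    (hf : ∀ i x, f i (φ i x) = k x) {h : H} {l : List (Σ i, G i)}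
    (h1 : toBohr _ (AlgPushout.base φ h * (l.map fun a => AlgPushout.of φ a.1 a.2).prod) = 1) :
    k h * (l.map fun a => f a.1 a.2).prod = 1 := by
  obtain ⟨F, ⟨hF, hFb⟩, -⟩ := compactPushout_existsUnique φ f k hf
  have := congrArg F h1
  rw [map_one, map_mul, map_mul, hFb, map_list_prod, map_list_prod, List.map_map,
    List.map_map] at this
  simpa [Function.comp_def, hF] using this

theorem AlgebraicallySound.coherentlyEmbeddable (hinj : ∀ i, Function.Injective (φ i))
    (hs : AlgebraicallySound φ) : CoherentlyEmbeddable φ := by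
  refine ⟨CompactPushout φ, inferInstance, inferInstance, inferInstance, inferInstance,
    inferInstance, fun i => (toBohr _).comp ⟨AlgPushout.of φ i, AlgPushout.continuous_of φ i⟩,
    fun i => hs.comp (Monoid.PushoutI.of_injective (φ := fun i => (φ i).toMonoidHom) hinj i),
    fun i j x => congrArg (toBohr _) ?_⟩
  exact (Monoid.PushoutI.of_apply_eq_base (fun i => (φ i).toMonoidHom) i x).trans
    (Monoid.PushoutI.of_apply_eq_base (fun i => (φ i).toMonoidHom) j x).symm

theorem CoherentlyEmbeddable.exists_injective [IsTopologicalGroup H] [CompactSpace H] [T2Space H]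
    (hinj : ∀ i, Function.Injective (φ i)) (hc : CoherentlyEmbeddable φ) :
    ∃ (K : Type u) (_ : Group K) (_ : TopologicalSpace K) (_ : IsTopologicalGroup K)
      (_ : CompactSpace K) (_ : T2Space K) (f : ∀ i, G i →ₜ* K) (k : H →ₜ* K),
      (∀ i x, f i (φ i x) = k x) ∧ Function.Injective k := by
  cases isEmpty_or_nonempty ι with
  -- For the empty family a coherent embedding carries no information on `H`, but `H` embeds in
  -- itself.
  | inl h => exact ⟨H, inferInstance, inferInstance, inferInstance, inferInstance, inferInstance,
      fun i => h.elim i, ContinuousMonoidHom.id H, fun i => h.elim i, Function.injective_id⟩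
  | inr h =>
    obtain ⟨i₀⟩ := h
    obtain ⟨K, _, _, _, _, _, j, hj, hjj⟩ := hc
    exact ⟨K, inferInstance, inferInstance, inferInstance, inferInstance, inferInstance, j,
      (j i₀).comp (φ i₀), fun i x => hjj i i₀ x, (hj i₀).comp (hinj i₀)⟩

theorem CoherentlyEmbeddable.algebraicallySound [IsTopologicalGroup H] [CompactSpace H] [T2Space H]
    [∀ i, IsTopologicalGroup (G i)] [∀ i, CompactSpace (G i)] [∀ i, T2Space (G i)]
    (hinj : ∀ i, Function.Injective (φ i)) (hnormal : ∀ i, (φ i).toMonoidHom.range.Normal)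
    (hc : CoherentlyEmbeddable φ) : AlgebraicallySound φ := by
  refine (injective_iff_map_eq_one (toBohr (AlgPushout φ))).2 fun γ hγ => ?_
  obtain ⟨h, w, hw, rfl⟩ := exists_base_mul_reduced φ hinj γ
  have hnil : w.toList = [] := by
    by_contra hne
    obtain ⟨X, _, _, ρ, hρ, hprod⟩ := exists_rep_prod_ne_one
      (fun i => ((φ i).toMonoidHom.range : Set (G i)))
      (fun i g hg => exists_orthogonal_rep_ne_one_of_notMem (φ i).toMonoidHom.range
        (isCompact_range (φ i).continuous_toFun).isClosed hg) w.toList w.chain_ne hw hne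
    refine hprod ?_
    -- The representations kill `H`, so they are compatible with the trivial morphism on `H` and the
    -- factor `h` disappears.
    have := map_eq_one_of_toBohr_eq_one ρ ⟨1, continuous_const⟩ (fun i x => hρ i _ ⟨x, rfl⟩) hγ
    exact (one_mul _).symm.trans this
  obtain ⟨K, _, _, _, _, _, f, k, hfk, hk⟩ := hc.exists_injective hinj
  have h1 := map_eq_one_of_toBohr_eq_one f k hfk hγ
  rw [hnil] at h1 ⊢
  simp only [List.map_nil, List.prod_nil, mul_one] at h1 ⊢
  rw [hk (h1.trans (map_one k).symm), map_one]

end Pushout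
end CompactAmalgam

theorem mainTheorem2 {ι H : Type u} [Group H] [TopologicalSpace H] [IsTopologicalGroup H]
    [CompactSpace H] [T2Space H] {G : ι → Type u} [∀ i, Group (G i)]
    [∀ i, TopologicalSpace (G i)] [∀ i, IsTopologicalGroup (G i)] [∀ i, CompactSpace (G i)]
    [∀ i, T2Space (G i)] (φ : ∀ i, H →ₜ* G i) (hinj : ∀ i, Function.Injective (φ i))
    (hnormal : ∀ i, (φ i).toMonoidHom.range.Normal) :
    CompactAmalgam.AlgebraicallySound φ ↔ CompactAmalgam.CoherentlyEmbeddable φ :=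
  ⟨fun h => h.coherentlyEmbeddable hinj, fun h => h.algebraicallySound hinj hnormal⟩
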